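/- **Convergence of the alternating fixed-point algorithm for density bands.** Let $\mu$ be a measure on a measurable space $\Omega$. For $i=0,1$ let a density band be given by measurable functions $p_i':\Omega\to[0,\infty)$ and $p_i'':\Omega\to[0,\infty]$ with $p_i'\le p_i''$ and $\int p_i'\,d\mu\le 1\le\int p_i''\,d\mu$, and let $\mathcal P_i$ be the set of probability densities $q$ with respect to $\mu$ such that $p_i'\le q\le p_i''$ $\mu$-a.e. Let $\alpha\ge 0$. Let $q_i^0\in\mathcal P_i$ be arbitrary, and suppose that for all $n\ge1$, $\mu$-a.e., $$q_0^n=\min\{p_0'',\max\{c_0^n(\alpha q_0^{n-1}+q_1^{n-1}),p_0'\}\},\qquad q_1^n=\min\{p_1'',\max\{c_1^n(q_0^{n}+\alpha q_1^{n-1}),p_1'\}\},$$ where $c_0^n,c_1^n>0$ are chosen such that both right-hand sides integrate to $1$ (that is, the iteration can be carried out; any such choice of constants is allowed). Write $\|\cdot\|$ for the norm of $L^1(\mu)$. Then: 1. $\|q_i^n-q_i^{n-1}\|\to0$ as $n\to\infty$, for $i=0,1$. 2. The iterates asymptotically satisfy the implicit equations of the least favorable densities: there are constants $d_0^n,d_1^n>0$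 with $\alpha d_i^n\le1$ (i.e. $d_i^n\in(0,1/\alpha]$) such that $$\bigl\|q_0^n-\min\{p_0'',\max\{d_0^n(\alpha q_0^{n}+q_1^{n}),p_0'\}\}\bigr\|\to0,\qquad \bigl\|q_1^n-\min\{p_1'',\max\{d_1^n(q_0^{n}+\alpha q_1^{n}),p_1'\}\}\bigr\|\to0 .$$ 3. Every limit point of the iterates is a solution: if $q_0^{n_k}\to q_0$ and $q_1^{n_k}\to q_1$ in $L^1(\mu)$ along a common subsequence, then $q_0\in\mathcal P_0$, $q_1\in\mathcal P_1$, and there are constants $c_0,c_1\ge0$ with $\alpha c_i\le1$, and $c_i>0$ whenever $\int p_i'\,d\mu<1$, such that $\mu$-a.e. $$q_0=\min\{p_0'',\max\{c_0(\alpha q_0+q_1),p_0'\}\},\qquad q_1=\min\{p_1'',\max\{c_1(q_0+\alpha q_1),p_1'\}\}.$$ -/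

import Mathlib

open MeasureTheory Filter Topology
open scoped NNReal ENNReal

/-- A density band `p' ≤ p ≤ p''` with respect to `μ`: `lower` is `p'`, `upper` is `p''`
(the upper bound may take the value `∞` and need not be integrable), and
`P'(Ω) ≤ 1 ≤ P''(Ω)`. -/
structure DensityBand {Ω : Type*} [MeasurableSpace Ω] (μ : Measure Ω) where
  lower : Ω → ℝ≥0
  upper : Ω → ℝ≥0∞
  measurable_lower : Measurable lower
  measurable_upper : Measurable upper
  lower_le_upper : ∀ ω, (lower ω : ℝ≥0∞) ≤ upper ω
  lintegral_lower_le : ∫⁻ ω, (lower ω : ℝ≥0∞) ∂μ ≤ 1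
  one_le_lintegral_upper : 1 ≤ ∫⁻ ω, upper ω ∂μ

namespace DensityBand

variable {Ω : Type*} [MeasurableSpace Ω] {μ : Measure Ω}

/-- `q` is the `μ`-density of a probability measure that belongs to the band. -/
structure Mem (B : DensityBand μ) (q : Ω → ℝ≥0) : Prop where
  aemeasurable : AEMeasurable q μ
  lintegral_eq_one : ∫⁻ ω, (q ω : ℝ≥0∞) ∂μ = 1
  lower_le : ∀ᵐ ω ∂μ, B.lower ω ≤ q ω
  le_upper : ∀ᵐ ω ∂μ, (q ω : ℝ≥0∞) ≤ B.upper ω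

/-- The function `min {p'', max {c p, p'}}`. -/
noncomputable def clip (B : DensityBand μ) (c : ℝ≥0) (p : Ω → ℝ≥0) (ω : Ω) : ℝ≥0 :=
  (min (B.upper ω) ((max (c * p ω) (B.lower ω) : ℝ≥0) : ℝ≥0∞)).toNNReal

/-- The minimum in `clip` is finite, so that passing to `ℝ≥0` changes nothing. -/
theorem coe_clip (B : DensityBand μ) (c : ℝ≥0) (p : Ω → ℝ≥0) (ω : Ω) :
    (B.clip c p ω : ℝ≥0∞) =
      min (B.upper ω) ((max (c * p ω) (B.lower ω) : ℝ≥0) : ℝ≥0∞) :=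
  ENNReal.coe_toNNReal (ne_top_of_le_ne_top ENNReal.coe_ne_top (min_le_right _ _))

/-- The function `g(c ; p) = ∫ min {p'', max {c p, p'}} dμ - 1`. -/
noncomputable def g (B : DensityBand μ) (c : ℝ≥0) (p : Ω → ℝ≥0) : ℝ :=
  (∫⁻ ω, (B.clip c p ω : ℝ≥0∞) ∂μ).toReal - 1

end DensityBand

/-- The implicit equations
`q₀ = min {p₀'', max {c₀ (α q₀ + q₁), p₀'}}` and `q₁ = min {p₁'', max {c₁ (q₀ + α q₁), p₁'}}`,
as equations between densities, that is, `μ`-almost everywhere. -/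
def SolvesImplicitEquations {Ω : Type*} [MeasurableSpace Ω] {μ : Measure Ω}
    (B₀ B₁ : DensityBand μ) (α c₀ c₁ : ℝ≥0) (q₀ q₁ : Ω → ℝ≥0) : Prop :=
  q₀ =ᵐ[μ] B₀.clip c₀ (fun ω => α * q₀ ω + q₁ ω) ∧
  q₁ =ᵐ[μ] B₁.clip c₁ (fun ω => q₀ ω + α * q₁ ω)

/-- `(q₀ n, q₁ n)` are the iterates of the alternating fixed-point algorithm, where `c₀ n` and
`c₁ n` are the roots that are computed in the pass from the `n`-th to the `(n+1)`-th iterate. -/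
structure IsAlgorithmRun {Ω : Type*} [MeasurableSpace Ω] {μ : Measure Ω}
    (B₀ B₁ : DensityBand μ) (α : ℝ≥0) (q₀ q₁ : ℕ → Ω → ℝ≥0) (c₀ c₁ : ℕ → ℝ≥0) : Prop where
  init₀ : B₀.Mem (q₀ 0)
  init₁ : B₁.Mem (q₁ 0)
  pos₀ : ∀ n, 0 < c₀ n
  root₀ : ∀ n, B₀.g (c₀ n) (fun ω => α * q₀ n ω + q₁ n ω) = 0
  step₀ : ∀ n, q₀ (n + 1) =ᵐ[μ] B₀.clip (c₀ n) (fun ω => α * q₀ n ω + q₁ n ω)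
  pos₁ : ∀ n, 0 < c₁ n
  root₁ : ∀ n, B₁.g (c₁ n) (fun ω => q₀ (n + 1) ω + α * q₁ n ω) = 0
  step₁ : ∀ n, q₁ (n + 1) =ᵐ[μ] B₁.clip (c₁ n) (fun ω => q₀ (n + 1) ω + α * q₁ n ω)

/-- The distance `‖p - q‖` in `L¹(μ)`, i.e. the total variation distance `∫ |p - q| dμ`. -/
noncomputable def l1Dist {Ω : Type*} [MeasurableSpace Ω] (μ : Measure Ω) (p q : Ω → ℝ≥0) :
    ℝ≥0∞ :=
  eLpNorm (fun ω => (p ω : ℝ) - (q ω : ℝ)) 1 μ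

/-!
Clipping projects `c (α q₀ + q₁)` onto the band, so the new `q₀` lies pointwise between the old
one and `s q₁`, where `s = c / (1 - α c)`. Hence no hockey-stick divergence `∫ (q₀ - t q₁)⁺`
increases along the algorithm, and the one with `t = s` drops by at least the mass that the step
moves. Each of these divergences converges, uniformly for bounded `t` as they are Lipschitz in `t`,
while the mass moved is at most `c / s` and thus small for large `s`. So the steps vanish provided
the roots `c` are bounded.

A root may be lowered to any constant whose clip still has mass at least one without changing the
density. If `α > 0`, the constant `1 / α` qualifies because its clip dominates the old `q₀`. If
`α = 0`, a constant bound propagates from pass to pass because the roots of the other band are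
bounded below, unless that band contains a single density.

Clipping is nonexpansive in `L¹`, so with bounded roots the asymptotic equations pass to limit
points.
-/

section UniformConvergence

theorem tendstoUniformlyOn_of_lipschitzWith {ι X Y : Type*} [PseudoMetricSpace X]
    [PseudoMetricSpace Y] {l : Filter ι} {F : ι → X → Y} {f : X → Y} {K : ℝ≥0} {s : Set X}
    (hF : ∀ i, LipschitzWith K (F i)) (hs : IsCompact s)
    (hlim : ∀ x ∈ s, Tendsto (F · x) l (𝓝 (f x))) : TendstoUniformlyOn F f l s := by
  have hequi : EquicontinuousOn F s :=
    (LipschitzWith.uniformEquicontinuous F K hF).equicontinuous.equicontinuousOn s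
  refine UniformOnFun.tendsto_iff_tendstoUniformlyOn.1
    ((EquicontinuousOn.tendsto_uniformOnFun_iff_pi' (𝔖 := {s}) (by simpa using hs)
      (by simpa using hequi) l f).2 ?_) s rfl
  exact tendsto_pi_nhds.2 fun x => hlim x (by simpa using x.2)

theorem tendsto_zero_of_le_of_mul_le {ι : Type*} {l : Filter ι} {D : ι → ℝ≥0 → ℝ} {K : ℝ≥0}
    (hD : ∀ i, LipschitzWith K (D i)) (hlim : ∀ t, Tendsto (D · t) l (𝓝 0))
    {δ : ι → ℝ} {s : ι → ℝ≥0} {M : ℝ≥0} (hδ : ∀ i, 0 ≤ δ i) (hle : ∀ i, δ i ≤ D i (s i))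
    (hmul : ∀ i, s i * δ i ≤ M) : Tendsto δ l (𝓝 0) := by
  rw [Metric.tendsto_nhds]
  intro ε hε
  lift ε to ℝ≥0 using hε.le
  have hunif := tendstoUniformlyOn_of_lipschitzWith hD (isCompact_Icc (a := (0 : ℝ≥0)) (b := M / ε))
    (fun t _ => hlim t)
  filter_upwards [Metric.tendstoUniformlyOn_iff.1 hunif ε hε] with i hi
  rw [Real.dist_0_eq_abs, abs_of_nonneg (hδ i)]
  rcases le_or_gt (s i) (M / ε) with hs | hs
  · have := hi (s i) ⟨zero_le, hs⟩
    rw [dist_comm, Real.dist_0_eq_abs] at this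
    exact (hle i).trans_lt ((le_abs_self _).trans_lt this)
  · by_contra! hεδ
    have hlt : (M : ℝ) < s i * ε := by exact_mod_cast (div_lt_iff₀ hε).1 hs
    exact (hmul i).not_gt (hlt.trans_le (by gcongr))

end UniformConvergence

section Pointwise

variable {a x y z : ℝ≥0}

theorem tsub_add_tsub_of_mem_uIcc (h : y ∈ Set.uIcc x z) : x - y + (y - z) = x - z := by
  rcases Set.mem_uIcc.1 h with ⟨hxy, hyz⟩ | ⟨hzy, hyx⟩
  · rw [tsub_eq_zero_of_le hxy, tsub_eq_zero_of_le hyz, tsub_eq_zero_of_le (hxy.trans hyz),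
      add_zero]
  · exact tsub_add_tsub_cancel hyx hzy

theorem mem_uIcc_div_of_mem_uIcc_add (ha : a < 1) (h : y ∈ Set.uIcc x (a * x + z)) :
    y ∈ Set.uIcc x (z / (1 - a)) := by
  have hpos : 0 < 1 - a := tsub_pos_of_lt ha
  rcases Set.mem_uIcc.1 h with ⟨hxy, hy⟩ | ⟨hy, hyx⟩
  · refine Set.mem_uIcc_of_le hxy ?_
    rw [le_div_iff₀ hpos, mul_tsub, mul_one, tsub_le_iff_left]
    calc y ≤ a * x + z := hy
      _ ≤ y * a + z := by rw [mul_comm y]; gcongr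
  · refine Set.mem_uIcc_of_ge ?_ hyx
    rw [div_le_iff₀ hpos, mul_tsub, mul_one]
    refine le_tsub_of_add_le_left ?_
    calc y * a + z ≤ a * x + z := by rw [mul_comm y]; gcongr
      _ ≤ y := hy

theorem mul_mem_uIcc_mul (c : ℝ≥0) (h : y ∈ Set.uIcc x z) : c * y ∈ Set.uIcc (c * x) (c * z) :=
  (monotone_mul_left_of_nonneg zero_le : Monotone (c * ·)).image_uIcc_subset
    (Set.mem_image_of_mem _ h)

end Pointwise

section ExcessMass

variable {Ω : Type*} [MeasurableSpace Ω] {μ : Measure Ω} {p q r y z : Ω → ℝ≥0}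

/-- The mass `∫ (p - q)⁺ dμ` by which `p` exceeds `q`, the subtraction of `ℝ≥0` being truncated.
The family `t ↦ excessMass μ p (t • q)` consists of the hockey-stick divergences of `p` and `q`. -/
noncomputable def excessMass (μ : Measure Ω) (p q : Ω → ℝ≥0) : ℝ≥0∞ :=
  ∫⁻ ω, ((p ω - q ω : ℝ≥0) : ℝ≥0∞) ∂μ

theorem aemeasurable_coe_tsub (hp : AEMeasurable p μ) (hq : AEMeasurable q μ) :
    AEMeasurable (fun ω => ((p ω - q ω : ℝ≥0) : ℝ≥0∞)) μ :=
  (hp.sub hq).coe_nnreal_ennreal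

theorem excessMass_le_lintegral (p q : Ω → ℝ≥0) : excessMass μ p q ≤ ∫⁻ ω, p ω ∂μ :=
  lintegral_mono fun _ => ENNReal.coe_le_coe.2 tsub_le_self

theorem lintegral_smul_density (c : ℝ≥0) (p : Ω → ℝ≥0) :
    ∫⁻ ω, ((c • p) ω : ℝ≥0∞) ∂μ = c * ∫⁻ ω, p ω ∂μ := by
  simp only [Pi.smul_apply, smul_eq_mul, ENNReal.coe_mul]
  exact lintegral_const_mul' _ _ ENNReal.coe_ne_top

theorem excessMass_smul_smul (c : ℝ≥0) (p q : Ω → ℝ≥0) :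
    excessMass μ (c • p) (c • q) = c * excessMass μ p q := by
  simp only [excessMass, Pi.smul_apply, smul_eq_mul, ← mul_tsub, ENNReal.coe_mul]
  exact lintegral_const_mul' _ _ ENNReal.coe_ne_top

theorem excessMass_add_lintegral (hp : AEMeasurable p μ) (hq : AEMeasurable q μ) :
    excessMass μ p q + ∫⁻ ω, q ω ∂μ = excessMass μ q p + ∫⁻ ω, p ω ∂μ := by
  rw [excessMass, excessMass, ← lintegral_add_right' _ hq.coe_nnreal_ennreal,
    ← lintegral_add_right' _ hp.coe_nnreal_ennreal]
  refine lintegral_congr fun ω => ?_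
  rw [← ENNReal.coe_add, ← ENNReal.coe_add, tsub_add_eq_max, tsub_add_eq_max, max_comm]

theorem excessMass_comm_of_lintegral_eq (hp : AEMeasurable p μ) (hq : AEMeasurable q μ)
    (hpq : ∫⁻ ω, p ω ∂μ = ∫⁻ ω, q ω ∂μ) (hfin : ∫⁻ ω, p ω ∂μ ≠ ∞) :
    excessMass μ p q = excessMass μ q p := by
  have h := excessMass_add_lintegral hp hq
  rwa [← hpq, ENNReal.add_left_inj hfin] at h

theorem excessMass_le_iff_of_lintegral_eq (hp : AEMeasurable p μ) (hq : AEMeasurable q μ)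
    (hz : AEMeasurable z μ) (hpq : ∫⁻ ω, p ω ∂μ = ∫⁻ ω, q ω ∂μ) (hpfin : ∫⁻ ω, p ω ∂μ ≠ ∞)
    (hzfin : ∫⁻ ω, z ω ∂μ ≠ ∞) :
    excessMass μ q z ≤ excessMass μ p z ↔ excessMass μ z q ≤ excessMass μ z p := by
  rw [← ENNReal.add_le_add_iff_right hzfin, excessMass_add_lintegral hq hz,
    excessMass_add_lintegral hp hz, ← hpq, ENNReal.add_le_add_iff_right hpfin]

theorem excessMass_add_excessMass_of_mem_uIcc (hp : AEMeasurable p μ) (hq : AEMeasurable q μ)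
    (h : ∀ᵐ ω ∂μ, q ω ∈ Set.uIcc (p ω) (r ω)) :
    excessMass μ p q + excessMass μ q r = excessMass μ p r := by
  rw [excessMass, excessMass, ← lintegral_add_left' (aemeasurable_coe_tsub hp hq)]
  refine lintegral_congr_ae (h.mono fun ω hω => ?_)
  exact congrArg ENNReal.ofNNReal (tsub_add_tsub_of_mem_uIcc hω)

theorem excessMass_le_of_mem_uIcc_of_le (h : ∀ᵐ ω ∂μ, q ω ∈ Set.uIcc (p ω) (y ω)) (hyz : y ≤ z) :
    excessMass μ q z ≤ excessMass μ p z := by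
  refine lintegral_mono_ae (h.mono fun ω hω => ENNReal.coe_le_coe.2 ?_)
  have hq : q ω ≤ max (p ω) (z ω) := hω.2.trans (max_le_max_left _ (hyz ω))
  exact (tsub_le_tsub_right hq _).trans_eq (by rw [← tsub_add_eq_max, add_tsub_cancel_right])

theorem excessMass_le_of_mem_uIcc_of_ge (h : ∀ᵐ ω ∂μ, q ω ∈ Set.uIcc (p ω) (y ω)) (hzy : z ≤ y) :
    excessMass μ z q ≤ excessMass μ z p := by
  refine lintegral_mono_ae (h.mono fun ω hω => ENNReal.coe_le_coe.2 ?_)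
  have hq : min (p ω) (z ω) ≤ q ω := (min_le_min_left _ (hzy ω)).trans hω.1
  exact (tsub_le_tsub_left hq _).trans_eq (by rw [min_comm, tsub_min])

theorem excessMass_smul_le_of_mem_uIcc {s : ℝ≥0} (hp : AEMeasurable p μ) (hq : AEMeasurable q μ)
    (hr : AEMeasurable r μ) (hpq : ∫⁻ ω, p ω ∂μ = ∫⁻ ω, q ω ∂μ) (hpfin : ∫⁻ ω, p ω ∂μ ≠ ∞)
    (hrfin : ∫⁻ ω, r ω ∂μ ≠ ∞) (h : ∀ᵐ ω ∂μ, q ω ∈ Set.uIcc (p ω) (s * r ω)) (a b : ℝ≥0) :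
    excessMass μ (a • q) (b • r) ≤ excessMass μ (a • p) (b • r) ∧
      excessMass μ (b • r) (a • q) ≤ excessMass μ (b • r) (a • p) := by
  have hiff := excessMass_le_iff_of_lintegral_eq (hp.const_smul a) (hq.const_smul a)
    (hr.const_smul b) (by simp only [lintegral_smul_density, hpq])
    (by rw [lintegral_smul_density]; exact ENNReal.mul_ne_top ENNReal.coe_ne_top hpfin)
    (by rw [lintegral_smul_density]; exact ENNReal.mul_ne_top ENNReal.coe_ne_top hrfin)
  have hscaled : ∀ᵐ ω ∂μ, (a • q) ω ∈ Set.uIcc ((a • p) ω) (((a * s) • r) ω) :=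
    h.mono fun ω hω => by simpa [mul_assoc] using mul_mem_uIcc_mul a hω
  rcases le_total (a * s) b with hb | hb
  · have hle := excessMass_le_of_mem_uIcc_of_le hscaled (smul_le_smul_of_nonneg_right hb zero_le)
    exact ⟨hle, hiff.1 hle⟩
  · have hle := excessMass_le_of_mem_uIcc_of_ge hscaled (smul_le_smul_of_nonneg_right hb zero_le)
    exact ⟨hiff.2 hle, hle⟩

theorem excessMass_triangle (p : Ω → ℝ≥0) (hq : AEMeasurable q μ) (hr : AEMeasurable r μ) :
    excessMass μ p r ≤ excessMass μ p q + excessMass μ q r := by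
  rw [excessMass, excessMass, excessMass, ← lintegral_add_right' _ (aemeasurable_coe_tsub hq hr)]
  refine lintegral_mono fun ω => ?_
  rw [← ENNReal.coe_add, ENNReal.coe_le_coe]
  exact tsub_le_tsub_add_tsub

theorem excessMass_add_add_le {p' q' : Ω → ℝ≥0} (hp : AEMeasurable p μ) (hq : AEMeasurable q μ) :
    excessMass μ (p + p') (q + q') ≤ excessMass μ p q + excessMass μ p' q' := by
  rw [excessMass, excessMass, excessMass, ← lintegral_add_left' (aemeasurable_coe_tsub hp hq)]
  refine lintegral_mono fun ω => ?_
  rw [← ENNReal.coe_add, ENNReal.coe_le_coe]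
  exact add_tsub_add_le_tsub_add_tsub

theorem excessMass_smul_smul_self (r : Ω → ℝ≥0) (s t : ℝ≥0) :
    excessMass μ (s • r) (t • r) = (s - t : ℝ≥0) * ∫⁻ ω, r ω ∂μ := by
  rw [← lintegral_smul_density]
  simp only [excessMass, Pi.smul_apply, smul_eq_mul, tsub_mul]

theorem lipschitzWith_excessMass_smul (hp : ∫⁻ ω, p ω ∂μ ≠ ∞) (hr : AEMeasurable r μ)
    (hrfin : ∫⁻ ω, r ω ∂μ ≠ ∞) :
    LipschitzWith (∫⁻ ω, r ω ∂μ).toNNReal fun t : ℝ≥0 => (excessMass μ p (t • r)).toReal := by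
  refine LipschitzWith.of_le_add_mul _ fun s t => ?_
  have hfin : ∀ q, excessMass μ p q ≠ ∞ := fun q =>
    ne_top_of_le_ne_top hp (excessMass_le_lintegral p q)
  have htri : (excessMass μ p (s • r)).toReal ≤
      (excessMass μ p (t • r)).toReal + (t - s : ℝ≥0) * (∫⁻ ω, r ω ∂μ).toReal := by
    have h := excessMass_triangle p (hr.const_smul t) (hr.const_smul s)
    rw [excessMass_smul_smul_self] at h
    have hprod := ENNReal.mul_ne_top (ENNReal.coe_ne_top (r := t - s)) hrfin
    have hreal := ENNReal.toReal_mono (ENNReal.add_ne_top.2 ⟨hfin _, hprod⟩) h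
    rwa [ENNReal.toReal_add (hfin _) hprod, ENNReal.toReal_mul, ENNReal.coe_toReal] at hreal
  have hdist : ((t - s : ℝ≥0) : ℝ) ≤ dist s t := by
    rw [dist_nndist, NNReal.nndist_eq]
    exact NNReal.coe_le_coe.2 (le_max_right _ _)
  rw [mul_comm]
  refine htri.trans ?_
  gcongr
  rfl

end ExcessMass

section L1Dist

variable {Ω : Type*} [MeasurableSpace Ω] {μ : Measure Ω} {p q r : Ω → ℝ≥0}

theorem l1Dist_eq_excessMass_add_excessMass (hp : AEMeasurable p μ) (hq : AEMeasurable q μ) :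
    l1Dist μ p q = excessMass μ p q + excessMass μ q p := by
  rw [l1Dist, eLpNorm_one_eq_lintegral_enorm, excessMass, excessMass,
    ← lintegral_add_left' (aemeasurable_coe_tsub hp hq)]
  refine lintegral_congr fun ω => ?_
  rw [enorm_eq_nnnorm, ← ENNReal.coe_add, ENNReal.coe_inj, ← NNReal.coe_inj, coe_nnnorm,
    Real.norm_eq_abs]
  rcases le_total (p ω) (q ω) with h | h
  · rw [tsub_eq_zero_of_le h, zero_add, NNReal.coe_sub h, abs_sub_comm,
      abs_of_nonneg (by simpa using h)]
  · rw [tsub_eq_zero_of_le h, add_zero, NNReal.coe_sub h, abs_of_nonneg (by simpa using h)]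

theorem l1Dist_self (p : Ω → ℝ≥0) : l1Dist μ p p = 0 := by
  simp [l1Dist]

theorem l1Dist_comm (p q : Ω → ℝ≥0) : l1Dist μ p q = l1Dist μ q p :=
  eLpNorm_sub_comm _ _ _ _

theorem l1Dist_congr {p' q' : Ω → ℝ≥0} (hp : p =ᵐ[μ] p') (hq : q =ᵐ[μ] q') :
    l1Dist μ p q = l1Dist μ p' q' :=
  eLpNorm_congr_ae (by filter_upwards [hp, hq] with ω hpω hqω; rw [hpω, hqω])

theorem l1Dist_triangle (hp : AEMeasurable p μ) (hq : AEMeasurable q μ) (hr : AEMeasurable r μ) :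
    l1Dist μ p r ≤ l1Dist μ p q + l1Dist μ q r := by
  simp only [l1Dist_eq_excessMass_add_excessMass, hp, hq, hr]
  calc _ ≤ excessMass μ p q + excessMass μ q r + (excessMass μ r q + excessMass μ q p) :=
        add_le_add (excessMass_triangle p hq hr) (excessMass_triangle r hq hp)
    _ = _ := by ring

theorem ae_eq_of_l1Dist_eq_zero (hp : AEMeasurable p μ) (hq : AEMeasurable q μ)
    (h : l1Dist μ p q = 0) : p =ᵐ[μ] q := by
  have hsub := (eLpNorm_eq_zero_iff
    (hp.coe_nnreal_real.sub hq.coe_nnreal_real).aestronglyMeasurable one_ne_zero).1 h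
  exact hsub.mono fun ω hω => NNReal.coe_injective (sub_eq_zero.1 hω)

theorem lintegral_le_add_l1Dist (hp : AEMeasurable p μ) (hq : AEMeasurable q μ) :
    ∫⁻ ω, q ω ∂μ ≤ ∫⁻ ω, p ω ∂μ + l1Dist μ p q :=
  calc ∫⁻ ω, (q ω : ℝ≥0∞) ∂μ ≤ excessMass μ p q + ∫⁻ ω, q ω ∂μ := le_add_self
    _ = ∫⁻ ω, p ω ∂μ + excessMass μ q p := by rw [excessMass_add_lintegral hp hq, add_comm]
    _ ≤ ∫⁻ ω, p ω ∂μ + l1Dist μ p q := by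
      rw [l1Dist_eq_excessMass_add_excessMass hp hq]
      gcongr
      exact le_add_self

theorem lintegral_eq_of_tendsto_l1Dist {ι : Type*} {l : Filter ι} [l.NeBot] {f : ι → Ω → ℝ≥0}
    {m : ℝ≥0∞} (hf : ∀ i, AEMeasurable (f i) μ) (hr : AEMeasurable r μ)
    (hm : ∀ i, ∫⁻ ω, f i ω ∂μ = m) (h : Tendsto (fun i => l1Dist μ (f i) r) l (𝓝 0)) :
    ∫⁻ ω, r ω ∂μ = m := by
  refine le_antisymm (ge_of_tendsto' (f := fun i => m + l1Dist μ (f i) r) (x := l) ?_ fun i => ?_)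
    (ge_of_tendsto' (f := fun i => ∫⁻ ω, r ω ∂μ + l1Dist μ (f i) r) (x := l) ?_ fun i => ?_)
  · simpa using h.const_add m
  · simpa only [hm] using lintegral_le_add_l1Dist (hf i) hr
  · simpa using h.const_add (∫⁻ ω, r ω ∂μ)
  · simpa only [hm, l1Dist_comm] using lintegral_le_add_l1Dist hr (hf i)

theorem l1Dist_smul_smul (c : ℝ≥0) (hp : AEMeasurable p μ) (hq : AEMeasurable q μ) :
    l1Dist μ (c • p) (c • q) = c * l1Dist μ p q := by
  rw [l1Dist_eq_excessMass_add_excessMass (hp.const_smul c) (hq.const_smul c),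
    excessMass_smul_smul, excessMass_smul_smul, ← mul_add,
    ← l1Dist_eq_excessMass_add_excessMass hp hq]

theorem l1Dist_add_add_le {p' q' : Ω → ℝ≥0} (hp : AEMeasurable p μ) (hq : AEMeasurable q μ)
    (hp' : AEMeasurable p' μ) (hq' : AEMeasurable q' μ) :
    l1Dist μ (p + p') (q + q') ≤ l1Dist μ p q + l1Dist μ p' q' := by
  rw [l1Dist_eq_excessMass_add_excessMass (hp.add hp') (hq.add hq'),
    l1Dist_eq_excessMass_add_excessMass hp hq, l1Dist_eq_excessMass_add_excessMass hp' hq',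
    add_add_add_comm]
  exact add_le_add (excessMass_add_add_le hp hq) (excessMass_add_add_le hq hp)

theorem l1Dist_smul_smul_self (hr : AEMeasurable r μ) (s t : ℝ≥0) :
    l1Dist μ (s • r) (t • r) = edist s t * ∫⁻ ω, r ω ∂μ := by
  rw [l1Dist_eq_excessMass_add_excessMass (hr.const_smul s) (hr.const_smul t),
    excessMass_smul_smul_self, excessMass_smul_smul_self, ← add_mul, edist_nndist,
    NNReal.nndist_eq, ← ENNReal.coe_add]
  congr 2
  rcases le_total s t with h | h <;> simp [tsub_eq_zero_of_le h]

theorem tendsto_l1Dist_smul {ι : Type*} {l : Filter ι} {d : ι → ℝ≥0} {e : ℝ≥0} {f : ι → Ω → ℝ≥0}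
    (hf : ∀ i, AEMeasurable (f i) μ) (hr : AEMeasurable r μ) (hrfin : ∫⁻ ω, r ω ∂μ ≠ ∞)
    (hd : Tendsto d l (𝓝 e)) (h : Tendsto (fun i => l1Dist μ (f i) r) l (𝓝 0)) :
    Tendsto (fun i => l1Dist μ (d i • f i) (e • r)) l (𝓝 0) := by
  have hbound : Tendsto (fun i => d i * l1Dist μ (f i) r + edist (d i) e * ∫⁻ ω, r ω ∂μ) l
      (𝓝 0) := by
    simpa using (ENNReal.Tendsto.mul (ENNReal.tendsto_coe.2 hd) (.inr ENNReal.zero_ne_top) h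
      (.inr ENNReal.coe_ne_top)).add (ENNReal.Tendsto.mul_const (tendsto_iff_edist_tendsto_0.1 hd)
      (.inr hrfin))
  refine tendsto_of_tendsto_of_tendsto_of_le_of_le tendsto_const_nhds hbound
    (fun _ => zero_le) fun i => ?_
  rw [← l1Dist_smul_smul _ (hf i) hr, ← l1Dist_smul_smul_self hr]
  exact l1Dist_triangle ((hf i).const_smul _) (hr.const_smul _) (hr.const_smul _)

theorem tendsto_l1Dist_add {ι : Type*} {l : Filter ι} {f g : ι → Ω → ℝ≥0}
    (hf : ∀ i, AEMeasurable (f i) μ) (hg : ∀ i, AEMeasurable (g i) μ) (hp : AEMeasurable p μ)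
    (hq : AEMeasurable q μ) (hfp : Tendsto (fun i => l1Dist μ (f i) p) l (𝓝 0))
    (hgq : Tendsto (fun i => l1Dist μ (g i) q) l (𝓝 0)) :
    Tendsto (fun i => l1Dist μ (f i + g i) (p + q)) l (𝓝 0) :=
  tendsto_of_tendsto_of_tendsto_of_le_of_le tendsto_const_nhds (by simpa using hfp.add hgq)
    (fun _ => zero_le) fun i => l1Dist_add_add_le (hf i) hp (hg i) hq

theorem l1Dist_eq_two_mul_excessMass (hp : AEMeasurable p μ) (hq : AEMeasurable q μ)
    (hpq : ∫⁻ ω, p ω ∂μ = ∫⁻ ω, q ω ∂μ) (hfin : ∫⁻ ω, p ω ∂μ ≠ ∞) :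
    l1Dist μ p q = 2 * excessMass μ p q := by
  rw [l1Dist_eq_excessMass_add_excessMass hp hq,
    ← excessMass_comm_of_lintegral_eq hp hq hpq hfin, two_mul]

end L1Dist

section Step

variable {Ω : Type*} [MeasurableSpace Ω] {μ : Measure Ω} {p q r : Ω → ℝ≥0}

theorem ae_eq_of_ae_le_of_lintegral_coe_le (hq : AEMeasurable q μ) (hle : p ≤ᵐ[μ] q)
    (hfin : ∫⁻ ω, p ω ∂μ ≠ ∞) (hqp : ∫⁻ ω, q ω ∂μ ≤ ∫⁻ ω, p ω ∂μ) : p =ᵐ[μ] q :=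
  (ae_eq_of_ae_le_of_lintegral_le (hle.mono fun _ => ENNReal.coe_le_coe.2) hfin
    hq.coe_nnreal_ennreal hqp).mono fun _ h => ENNReal.coe_injective h

theorem excessMass_le_of_mem_uIcc_add {κ : ℝ≥0}
    (h : ∀ᵐ ω ∂μ, q ω ∈ Set.uIcc (p ω) (κ * p ω + r ω)) (hκ : κ ≤ 1) :
    excessMass μ p q ≤ (1 - κ : ℝ≥0) * ∫⁻ ω, p ω ∂μ := by
  rw [← lintegral_smul_density]
  refine lintegral_mono_ae (h.mono fun ω hω => ENNReal.coe_le_coe.2 ?_)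
  have hq : κ * p ω ≤ q ω := (le_min (mul_le_of_le_one_left' hκ) le_self_add).trans hω.1
  exact (tsub_le_tsub_left hq _).trans_eq (by simp [tsub_mul])

theorem exists_mem_uIcc_mul_of_mem_uIcc_add {κ d : ℝ≥0} (hq : AEMeasurable q μ)
    (hpq : ∫⁻ ω, p ω ∂μ = ∫⁻ ω, q ω ∂μ) (hfin : ∫⁻ ω, p ω ∂μ ≠ ∞) (hκ : κ ≤ 1)
    (h : ∀ᵐ ω ∂μ, q ω ∈ Set.uIcc (p ω) (κ * p ω + d * r ω)) :
    ∃ s : ℝ≥0, (∀ᵐ ω ∂μ, q ω ∈ Set.uIcc (p ω) (s * r ω)) ∧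
      s * excessMass μ p q ≤ d * ∫⁻ ω, p ω ∂μ := by
  rcases hκ.lt_or_eq with hlt | rfl
  · have hne : 1 - κ ≠ 0 := (tsub_pos_of_lt hlt).ne'
    refine ⟨d / (1 - κ), h.mono fun ω hω => ?_, ?_⟩
    · rw [div_mul_eq_mul_div]
      exact mem_uIcc_div_of_mem_uIcc_add hlt hω
    · calc ((d / (1 - κ) : ℝ≥0) : ℝ≥0∞) * excessMass μ p q
          ≤ (d / (1 - κ) : ℝ≥0) * ((1 - κ : ℝ≥0) * ∫⁻ ω, p ω ∂μ) := by
            gcongr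
            exact excessMass_le_of_mem_uIcc_add h hκ
        _ = d * ∫⁻ ω, p ω ∂μ := by rw [← mul_assoc, ← ENNReal.coe_mul, div_mul_cancel₀ _ hne]
  · have hle : p ≤ᵐ[μ] q := h.mono fun ω hω => by simpa using hω.1
    have heq : p =ᵐ[μ] q := ae_eq_of_ae_le_of_lintegral_coe_le hq hle hfin hpq.ge
    exact ⟨0, heq.mono fun ω hω => hω ▸ Set.left_mem_uIcc, by simp⟩

end Step

namespace DensityBand

variable {Ω : Type*} [MeasurableSpace Ω] {μ : Measure Ω} {B : DensityBand μ} {c d M : ℝ≥0}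
  {p q r : Ω → ℝ≥0} {ω : Ω} {x : ℝ≥0}

theorem lower_le_clip (B : DensityBand μ) (c : ℝ≥0) (p : Ω → ℝ≥0) (ω : Ω) :
    B.lower ω ≤ B.clip c p ω := by
  rw [← ENNReal.coe_le_coe, coe_clip]
  exact le_min (B.lower_le_upper ω) (ENNReal.coe_le_coe.2 (le_max_right _ _))

theorem clip_le_upper (B : DensityBand μ) (c : ℝ≥0) (p : Ω → ℝ≥0) (ω : Ω) :
    (B.clip c p ω : ℝ≥0∞) ≤ B.upper ω := by
  rw [coe_clip]
  exact min_le_left _ _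

theorem clip_le_max (B : DensityBand μ) (c : ℝ≥0) (p : Ω → ℝ≥0) (ω : Ω) :
    B.clip c p ω ≤ max (c * p ω) (B.lower ω) := by
  rw [← ENNReal.coe_le_coe, coe_clip]
  exact min_le_right _ _

theorem le_clip (hu : (x : ℝ≥0∞) ≤ B.upper ω) (hx : x ≤ max (c * p ω) (B.lower ω)) :
    x ≤ B.clip c p ω := by
  rw [← ENNReal.coe_le_coe, coe_clip]
  exact le_min hu (ENNReal.coe_le_coe.2 hx)

theorem clip_mono (h : c * p ω ≤ d * r ω) : B.clip c p ω ≤ B.clip d r ω :=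
  le_clip (B.clip_le_upper c p ω) ((B.clip_le_max c p ω).trans (max_le_max_right _ h))

theorem clip_zero (B : DensityBand μ) (p : Ω → ℝ≥0) (ω : Ω) : B.clip 0 p ω = B.lower ω :=
  le_antisymm ((B.clip_le_max 0 p ω).trans (by simp)) (B.lower_le_clip 0 p ω)

theorem clip_mem_uIcc (hl : B.lower ω ≤ x) (hu : (x : ℝ≥0∞) ≤ B.upper ω) :
    B.clip c p ω ∈ Set.uIcc x (c * p ω) := by
  refine ⟨le_clip ((ENNReal.coe_le_coe.2 inf_le_left).trans hu) (inf_le_right.trans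
    (le_max_left _ _)), (B.clip_le_max c p ω).trans (max_le le_sup_right (hl.trans le_sup_left))⟩

theorem clip_tsub_clip_le (B : DensityBand μ) (c d : ℝ≥0) (p r : Ω → ℝ≥0) (ω : Ω) :
    B.clip c p ω - B.clip d r ω ≤ c * p ω - d * r ω := by
  rcases le_or_gt (B.clip c p ω) (B.clip d r ω) with h | h
  · simp [tsub_eq_zero_of_le h]
  · have hp := (clip_mem_uIcc (c := c) (p := p) (B.lower_le_clip d r ω) (B.clip_le_upper d r ω)).2
    have hr := (clip_mem_uIcc (c := d) (p := r) (B.lower_le_clip c p ω) (B.clip_le_upper c p ω)).1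
    exact tsub_le_tsub ((le_sup_iff.1 hp).resolve_left h.not_ge)
      ((inf_le_iff.1 hr).resolve_left h.not_ge)

theorem aemeasurable_clip (B : DensityBand μ) (c : ℝ≥0) (hp : AEMeasurable p μ) :
    AEMeasurable (B.clip c p) μ :=
  (B.measurable_upper.aemeasurable.min
    ((hp.const_mul c).max B.measurable_lower.aemeasurable).coe_nnreal_ennreal).ennreal_toNNReal

theorem l1Dist_clip_le (B : DensityBand μ) (c d : ℝ≥0) (hp : AEMeasurable p μ)
    (hr : AEMeasurable r μ) :
    l1Dist μ (B.clip c p) (B.clip d r) ≤ l1Dist μ (c • p) (d • r) := by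
  rw [l1Dist_eq_excessMass_add_excessMass (B.aemeasurable_clip c hp) (B.aemeasurable_clip d hr),
    l1Dist_eq_excessMass_add_excessMass (hp.const_smul c) (hr.const_smul d)]
  exact add_le_add
    (lintegral_mono fun ω => ENNReal.coe_le_coe.2 (B.clip_tsub_clip_le c d p r ω))
    (lintegral_mono fun ω => ENNReal.coe_le_coe.2 (B.clip_tsub_clip_le d c r p ω))

theorem l1Dist_clip_smul_add_le {α : ℝ≥0} (hαd : α * d ≤ 1) (hp : AEMeasurable p μ)
    (hq : AEMeasurable q μ) (hr : AEMeasurable r μ) :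
    l1Dist μ (B.clip d (fun ω => α * p ω + r ω)) (B.clip d (fun ω => α * q ω + r ω)) ≤
      l1Dist μ p q := by
  have hpr : AEMeasurable (α • p + r) μ := (hp.const_smul α).add hr
  have hqr : AEMeasurable (α • q + r) μ := (hq.const_smul α).add hr
  have hadd : l1Dist μ (α • p + r) (α • q + r) ≤ α * l1Dist μ p q := by
    simpa [l1Dist_smul_smul α hp hq, l1Dist_self] using
      l1Dist_add_add_le (hp.const_smul α) (hq.const_smul α) hr hr
  calc l1Dist μ (B.clip d (α • p + r)) (B.clip d (α • q + r))
      ≤ l1Dist μ (d • (α • p + r)) (d • (α • q + r)) := B.l1Dist_clip_le d d hpr hqr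
    _ ≤ d * (α * l1Dist μ p q) := by
        rw [l1Dist_smul_smul d hpr hqr]
        gcongr
    _ = (α * d : ℝ≥0) * l1Dist μ p q := by rw [← mul_assoc, ← ENNReal.coe_mul, mul_comm d]
    _ ≤ l1Dist μ p q := mul_le_of_le_one_left' (ENNReal.coe_le_one_iff.2 hαd)

theorem lintegral_clip_of_g_eq_zero (h : B.g c p = 0) : ∫⁻ ω, B.clip c p ω ∂μ = 1 :=
  (ENNReal.toReal_eq_one_iff _).1 (sub_eq_zero.1 h)

theorem lintegral_clip_le (B : DensityBand μ) (c : ℝ≥0) (p : Ω → ℝ≥0) :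
    ∫⁻ ω, B.clip c p ω ∂μ ≤ c * ∫⁻ ω, p ω ∂μ + ∫⁻ ω, B.lower ω ∂μ := by
  rw [← lintegral_smul_density,
    ← lintegral_add_right _ B.measurable_lower.coe_nnreal_ennreal]
  refine lintegral_mono fun ω => ?_
  rw [← ENNReal.coe_add, ENNReal.coe_le_coe]
  exact (B.clip_le_max c p ω).trans (max_le le_self_add le_add_self)

theorem clip_ae_eq_clip_min (hp : AEMeasurable p μ) (hc : ∫⁻ ω, B.clip c p ω ∂μ = 1)
    (hM : 1 ≤ ∫⁻ ω, B.clip M p ω ∂μ) : B.clip c p =ᵐ[μ] B.clip (min c M) p := by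
  rcases le_total c M with h | h
  · rw [min_eq_left h]
  · rw [min_eq_right h]
    have hle : B.clip M p ≤ B.clip c p := fun ω => clip_mono (by gcongr)
    have hM' : ∫⁻ ω, B.clip M p ω ∂μ = 1 :=
      hM.antisymm' (hc ▸ lintegral_mono fun ω => ENNReal.coe_le_coe.2 (hle ω))
    exact (ae_eq_of_ae_le_of_lintegral_coe_le (B.aemeasurable_clip c hp) (.of_forall hle)
      (hM' ▸ ENNReal.one_ne_top) (hc.trans hM'.symm).le).symm

theorem Mem.of_ae_eq_clip (hqm : AEMeasurable q μ) (hq : q =ᵐ[μ] B.clip c p)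
    (hq1 : ∫⁻ ω, q ω ∂μ = 1) : B.Mem q where
  aemeasurable := hqm
  lintegral_eq_one := hq1
  lower_le := hq.mono fun ω hω => hω ▸ B.lower_le_clip c p ω
  le_upper := hq.mono fun ω hω => hω ▸ B.clip_le_upper c p ω

theorem Mem.of_ae_eq_clip_of_g_eq_zero (hp : AEMeasurable p μ) (hc : B.g c p = 0)
    (hq : q =ᵐ[μ] B.clip c p) : B.Mem q :=
  .of_ae_eq_clip ((B.aemeasurable_clip c hp).congr hq.symm) hq <|
    (lintegral_congr_ae (hq.mono fun _ hω => congrArg ENNReal.ofNNReal hω)).trans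
      (lintegral_clip_of_g_eq_zero hc)

theorem Mem.pos_of_ae_eq_clip (hq : B.Mem q) (heq : q =ᵐ[μ] B.clip c p)
    (hlt : ∫⁻ ω, B.lower ω ∂μ < 1) : 0 < c := by
  refine pos_iff_ne_zero.2 ?_
  rintro rfl
  refine hlt.ne ?_
  rw [← hq.lintegral_eq_one]
  exact lintegral_congr_ae (heq.mono fun ω hω => by simp only [hω, clip_zero])

theorem Mem.mem_uIcc_of_ae_eq_clip (hq : B.Mem q) (hr : r =ᵐ[μ] B.clip c p) :
    ∀ᵐ ω ∂μ, r ω ∈ Set.uIcc (q ω) (c * p ω) := by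
  filter_upwards [hr, hq.lower_le, hq.le_upper] with ω hω hl hu
  exact hω ▸ clip_mem_uIcc hl hu

theorem exists_ae_eq_clip_of_tendsto {d : ℕ → ℝ≥0} {f w : ℕ → Ω → ℝ≥0} {v : Ω → ℝ≥0}
    (hd : ∀ n, d n ≤ M) (hf : ∀ n, AEMeasurable (f n) μ) (hw : ∀ n, AEMeasurable (w n) μ)
    (hr : AEMeasurable r μ) (hv : AEMeasurable v μ) (hvfin : ∫⁻ ω, v ω ∂μ ≠ ∞)
    (hfr : Tendsto (fun n => l1Dist μ (f n) r) atTop (𝓝 0))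
    (hwv : Tendsto (fun n => l1Dist μ (w n) v) atTop (𝓝 0))
    (hclip : Tendsto (fun n => l1Dist μ (f n) (B.clip (d n) (w n))) atTop (𝓝 0)) :
    ∃ e ≤ M, r =ᵐ[μ] B.clip e v := by
  obtain ⟨e, he, ψ, hψ, hlim⟩ := (isCompact_Icc (a := (0 : ℝ≥0)) (b := M)).tendsto_subseq
    (x := d) fun n => ⟨zero_le, hd n⟩
  have hsmul := tendsto_l1Dist_smul (fun n => hw (ψ n)) hv hvfin hlim
    (hwv.comp hψ.tendsto_atTop)
  have hsum := ((hfr.add hclip).comp hψ.tendsto_atTop).add hsmul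
  rw [add_zero, add_zero] at hsum
  refine ⟨e, he.2, ae_eq_of_l1Dist_eq_zero hr (B.aemeasurable_clip e hv)
    (le_antisymm (ge_of_tendsto' hsum fun n => ?_) zero_le)⟩
  have hclipn := B.aemeasurable_clip (d (ψ n)) (hw (ψ n))
  calc l1Dist μ r (B.clip e v)
      ≤ l1Dist μ r (B.clip (d (ψ n)) (w (ψ n))) +
          l1Dist μ (B.clip (d (ψ n)) (w (ψ n))) (B.clip e v) :=
        l1Dist_triangle hr hclipn (B.aemeasurable_clip e hv)
    _ ≤ l1Dist μ (f (ψ n)) r + l1Dist μ (f (ψ n)) (B.clip (d (ψ n)) (w (ψ n))) +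
          l1Dist μ (d (ψ n) • w (ψ n)) (e • v) := by
        rw [l1Dist_comm (f (ψ n)) r]
        exact add_le_add (l1Dist_triangle hr (hf _) hclipn) (B.l1Dist_clip_le _ _ (hw _) hv)

theorem Mem.exists_ae_eq_clip_smul_add_of_tendsto {B' : DensityBand μ} {α : ℝ≥0} {d : ℕ → ℝ≥0}
    {f g : ℕ → Ω → ℝ≥0} {s : Ω → ℝ≥0} (hf : ∀ n, B.Mem (f n)) (hg : ∀ n, B'.Mem (g n))
    (hd : ∀ n, d n ≤ M) (hr : AEMeasurable r μ) (hs : AEMeasurable s μ)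
    (hfr : Tendsto (fun n => l1Dist μ (f n) r) atTop (𝓝 0))
    (hgs : Tendsto (fun n => l1Dist μ (g n) s) atTop (𝓝 0))
    (hclip : Tendsto (fun n => l1Dist μ (f n) (B.clip (d n) (fun ω => α * f n ω + g n ω)))
      atTop (𝓝 0)) :
    B.Mem r ∧ ∃ e ≤ M, (∫⁻ ω, B.lower ω ∂μ < 1 → 0 < e) ∧
      r =ᵐ[μ] B.clip e (fun ω => α * r ω + s ω) := by
  have hr1 := lintegral_eq_of_tendsto_l1Dist (fun n => (hf n).aemeasurable) hr
    (fun n => (hf n).lintegral_eq_one) hfr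
  have hs1 := lintegral_eq_of_tendsto_l1Dist (fun n => (hg n).aemeasurable) hs
    (fun n => (hg n).lintegral_eq_one) hgs
  have hlim : Tendsto (fun n => l1Dist μ (α • f n + g n) (α • r + s)) atTop (𝓝 0) :=
    tendsto_l1Dist_add
      (fun n => (hf n).aemeasurable.const_smul α) (fun n => (hg n).aemeasurable)
      (hr.const_smul α) hs
      (tendsto_l1Dist_smul (fun n => (hf n).aemeasurable) hr (hr1 ▸ ENNReal.one_ne_top)
        tendsto_const_nhds hfr) hgs
  have hfin : ∫⁻ ω, (α • r + s) ω ∂μ ≠ ∞ := by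
    simp [lintegral_add_right' _ hs.coe_nnreal_ennreal, lintegral_const_mul', hr1, hs1]
  obtain ⟨e, he, heq⟩ := exists_ae_eq_clip_of_tendsto hd (fun n => (hf n).aemeasurable)
    (fun n => ((hf n).aemeasurable.const_smul α).add (hg n).aemeasurable) hr
    ((hr.const_smul α).add hs) hfin hfr hlim hclip
  have hmem : B.Mem r := .of_ae_eq_clip hr heq hr1
  exact ⟨hmem, e, he, hmem.pos_of_ae_eq_clip heq, heq⟩

end DensityBand

namespace IsAlgorithmRun

variable {Ω : Type*} [MeasurableSpace Ω] {μ : Measure Ω} {B₀ B₁ : DensityBand μ} {α : ℝ≥0}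
  {q₀ q₁ : ℕ → Ω → ℝ≥0} {c₀ c₁ : ℕ → ℝ≥0}

theorem mem (h : IsAlgorithmRun B₀ B₁ α q₀ q₁ c₀ c₁) (n : ℕ) : B₀.Mem (q₀ n) ∧ B₁.Mem (q₁ n) := by
  induction n with
  | zero => exact ⟨h.init₀, h.init₁⟩
  | succ n ih =>
    have hq₀ : B₀.Mem (q₀ (n + 1)) := .of_ae_eq_clip_of_g_eq_zero
      ((ih.1.aemeasurable.const_mul α).add ih.2.aemeasurable) (h.root₀ n) (h.step₀ n)
    exact ⟨hq₀, .of_ae_eq_clip_of_g_eq_zero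
      (hq₀.aemeasurable.add (ih.2.aemeasurable.const_mul α)) (h.root₁ n) (h.step₁ n)⟩

theorem mem₀ (h : IsAlgorithmRun B₀ B₁ α q₀ q₁ c₀ c₁) (n : ℕ) : B₀.Mem (q₀ n) :=
  (h.mem n).1

theorem mem₁ (h : IsAlgorithmRun B₀ B₁ α q₀ q₁ c₀ c₁) (n : ℕ) : B₁.Mem (q₁ n) :=
  (h.mem n).2

/-- The run that starts after the first half pass, with the two bands exchanged. -/
theorem swap (h : IsAlgorithmRun B₀ B₁ α q₀ q₁ c₀ c₁) :
    IsAlgorithmRun B₁ B₀ α q₁ (fun n => q₀ (n + 1)) c₁ (fun n => c₀ (n + 1)) where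
  init₀ := h.init₁
  init₁ := h.mem₀ 1
  pos₀ := h.pos₁
  root₀ n := by simpa only [add_comm] using h.root₁ n
  step₀ n := by simpa only [add_comm] using h.step₁ n
  pos₁ n := h.pos₀ (n + 1)
  root₁ n := by simpa only [add_comm (α * _)] using h.root₀ (n + 1)
  step₁ n := by simpa only [add_comm (α * _)] using h.step₀ (n + 1)

theorem step₀_min_of_ae_le (h : IsAlgorithmRun B₀ B₁ α q₀ q₁ c₀ c₁) {M : ℝ≥0} {n : ℕ}
    {f : Ω → ℝ≥0} (hf : ∫⁻ ω, f ω ∂μ = 1)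
    (hle : f ≤ᵐ[μ] B₀.clip M (fun ω => α * q₀ n ω + q₁ n ω)) :
    q₀ (n + 1) =ᵐ[μ] B₀.clip (min (c₀ n) M) (fun ω => α * q₀ n ω + q₁ n ω) := by
  refine (h.step₀ n).trans (DensityBand.clip_ae_eq_clip_min
    (((h.mem₀ n).aemeasurable.const_mul α).add (h.mem₁ n).aemeasurable)
    (DensityBand.lintegral_clip_of_g_eq_zero (h.root₀ n)) ?_)
  rw [← hf]
  exact lintegral_mono_ae (hle.mono fun ω => ENNReal.coe_le_coe.2)

theorem one_le_root₁_add_lintegral_lower (h : IsAlgorithmRun B₀ B₁ 0 q₀ q₁ c₀ c₁) (n : ℕ) :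
    1 ≤ c₁ n + ∫⁻ ω, B₁.lower ω ∂μ := by
  have hle := B₁.lintegral_clip_le (c₁ n) fun ω => q₀ (n + 1) ω + 0 * q₁ n ω
  rw [DensityBand.lintegral_clip_of_g_eq_zero (h.root₁ n)] at hle
  simpa [(h.mem₀ (n + 1)).lintegral_eq_one] using hle

theorem exists_ae_le_succ_or_le_mul (h : IsAlgorithmRun B₀ B₁ 0 q₀ q₁ c₀ c₁) :
    ∃ K : ℝ≥0, ∀ n, ∀ᵐ ω ∂μ, q₁ n ω ≤ q₁ (n + 1) ω ∨ q₀ (n + 1) ω ≤ K * q₁ (n + 1) ω := by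
  rcases B₁.lintegral_lower_le.lt_or_eq with hlt | heq
  · lift ∫⁻ ω, B₁.lower ω ∂μ to ℝ≥0 using hlt.ne_top with m hm
    have hpos : 0 < 1 - m := tsub_pos_of_lt (by exact_mod_cast hlt)
    refine ⟨(1 - m)⁻¹, fun n => ?_⟩
    have hroot : 1 - m ≤ c₁ n := by
      have := h.one_le_root₁_add_lintegral_lower n
      rw [← hm] at this
      exact tsub_le_iff_right.2 (by exact_mod_cast this)
    filter_upwards [(h.mem₁ n).mem_uIcc_of_ae_eq_clip (h.step₁ n)] with ω hω
    refine (inf_le_iff.1 hω.1).imp_right fun hle => ?_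
    rw [le_inv_mul_iff₀ hpos]
    calc (1 - m) * q₀ (n + 1) ω ≤ c₁ n * q₀ (n + 1) ω := by gcongr
      _ ≤ q₁ (n + 1) ω := by simpa using hle
  · have hrigid : ∀ k, B₁.lower =ᵐ[μ] q₁ k := fun k =>
      ae_eq_of_ae_le_of_lintegral_coe_le (h.mem₁ k).aemeasurable (h.mem₁ k).lower_le
        (heq ▸ ENNReal.one_ne_top) ((h.mem₁ k).lintegral_eq_one.trans heq.symm).le
    exact ⟨0, fun n => ((hrigid n).symm.trans (hrigid (n + 1))).mono fun ω hω => .inl hω.le⟩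

theorem exists_root_bound_of_eq_zero (h : IsAlgorithmRun B₀ B₁ 0 q₀ q₁ c₀ c₁) :
    ∃ M : ℝ≥0, 0 < M ∧ ∀ n, q₀ (n + 1) =ᵐ[μ] B₀.clip (min (c₀ n) M)
      (fun ω => 0 * q₀ n ω + q₁ n ω) := by
  obtain ⟨K, hK⟩ := h.exists_ae_le_succ_or_le_mul
  set M := max (c₀ 0) K
  suffices hbound : ∀ n, q₀ (n + 1) ≤ᵐ[μ] B₀.clip M (fun ω => 0 * q₀ n ω + q₁ n ω) from
    ⟨M, lt_max_of_lt_left (h.pos₀ 0), fun n =>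
      h.step₀_min_of_ae_le (h.mem₀ (n + 1)).lintegral_eq_one (hbound n)⟩
  intro n
  induction n with
  | zero =>
    filter_upwards [h.step₀ 0] with ω hω
    rw [hω]
    exact DensityBand.clip_mono (by gcongr; exact le_max_left _ _)
  | succ n ih =>
    have hprev : q₀ (n + 1) ≤ᵐ[μ]
        B₀.clip M (fun ω => 0 * q₀ (n + 1) ω + q₁ (n + 1) ω) := by
      filter_upwards [ih, hK n, (h.mem₀ (n + 1)).le_upper] with ω hih hω hu
      rcases hω with hmono | hle
      · exact hih.trans (DensityBand.clip_mono (by simpa using by gcongr))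
      · refine DensityBand.le_clip hu (hle.trans (le_max_of_le_left ?_))
        simpa using mul_le_mul_left (le_max_right (c₀ 0) K) _
    filter_upwards [h.step₀_min_of_ae_le (h.mem₀ (n + 1)).lintegral_eq_one hprev] with ω hω
    rw [hω]
    exact DensityBand.clip_mono (by gcongr; exact min_le_right _ _)

theorem exists_root_bound (h : IsAlgorithmRun B₀ B₁ α q₀ q₁ c₀ c₁) :
    ∃ M : ℝ≥0, 0 < M ∧ α * M ≤ 1 ∧ ∀ n, q₀ (n + 1) =ᵐ[μ] B₀.clip (min (c₀ n) M)
      (fun ω => α * q₀ n ω + q₁ n ω) := by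
  rcases eq_zero_or_pos α with rfl | hα
  · obtain ⟨M, hpos, hstep⟩ := h.exists_root_bound_of_eq_zero
    exact ⟨M, hpos, by simp, hstep⟩
  · refine ⟨α⁻¹, inv_pos.2 hα, (mul_inv_cancel₀ hα.ne').le, fun n => ?_⟩
    refine h.step₀_min_of_ae_le (h.mem₀ n).lintegral_eq_one ?_
    filter_upwards [(h.mem₀ n).le_upper] with ω hω
    refine DensityBand.le_clip hω (le_max_of_le_left ?_)
    rw [mul_add, inv_mul_cancel_left₀ hα.ne']
    exact le_self_add

theorem exists_mem_uIcc_mul (h : IsAlgorithmRun B₀ B₁ α q₀ q₁ c₀ c₁) :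
    ∃ M : ℝ≥0, ∀ n, ∃ s : ℝ≥0, (∀ᵐ ω ∂μ, q₀ (n + 1) ω ∈ Set.uIcc (q₀ n ω) (s * q₁ n ω)) ∧
      s * excessMass μ (q₀ n) (q₀ (n + 1)) ≤ M := by
  obtain ⟨M, -, hαM, hstep⟩ := h.exists_root_bound
  refine ⟨M, fun n => ?_⟩
  have hmem := (h.mem₀ n).mem_uIcc_of_ae_eq_clip (hstep n)
  simp only [mul_add, ← mul_assoc] at hmem
  have hmass := (h.mem₀ n).lintegral_eq_one
  obtain ⟨s, hs, hexcess⟩ := exists_mem_uIcc_mul_of_mem_uIcc_add (h.mem₀ (n + 1)).aemeasurable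
    (hmass.trans (h.mem₀ (n + 1)).lintegral_eq_one.symm) (hmass ▸ ENNReal.one_ne_top)
    (le_trans (by rw [mul_comm]; gcongr; exact min_le_right _ _) hαM) hmem
  refine ⟨s, hs, hexcess.trans ?_⟩
  rw [hmass, mul_one]
  exact ENNReal.coe_le_coe.2 (min_le_right _ _)

theorem excessMass_smul_succ₀_le (h : IsAlgorithmRun B₀ B₁ α q₀ q₁ c₀ c₁) (n : ℕ) (a b : ℝ≥0) :
    excessMass μ (a • q₀ (n + 1)) (b • q₁ n) ≤ excessMass μ (a • q₀ n) (b • q₁ n) ∧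
      excessMass μ (b • q₁ n) (a • q₀ (n + 1)) ≤ excessMass μ (b • q₁ n) (a • q₀ n) := by
  obtain ⟨M, hM⟩ := h.exists_mem_uIcc_mul
  obtain ⟨s, hs, -⟩ := hM n
  exact excessMass_smul_le_of_mem_uIcc (h.mem₀ n).aemeasurable (h.mem₀ (n + 1)).aemeasurable
    (h.mem₁ n).aemeasurable
    ((h.mem₀ n).lintegral_eq_one.trans (h.mem₀ (n + 1)).lintegral_eq_one.symm)
    ((h.mem₀ n).lintegral_eq_one ▸ ENNReal.one_ne_top)
    ((h.mem₁ n).lintegral_eq_one ▸ ENNReal.one_ne_top) hs a b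

theorem excessMass_smul_succ₁_le (h : IsAlgorithmRun B₀ B₁ α q₀ q₁ c₀ c₁) (t : ℝ≥0) (n : ℕ) :
    excessMass μ (q₀ (n + 1)) (t • q₁ (n + 1)) ≤ excessMass μ (q₀ (n + 1)) (t • q₁ n) := by
  simpa using (h.swap.excessMass_smul_succ₀_le n t 1).2

theorem antitone_excessMass (h : IsAlgorithmRun B₀ B₁ α q₀ q₁ c₀ c₁) (t : ℝ≥0) :
    Antitone fun n => excessMass μ (q₀ n) (t • q₁ n) :=
  antitone_nat_of_succ_le fun n => (h.excessMass_smul_succ₁_le t n).trans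
    (by simpa using (h.excessMass_smul_succ₀_le n 1 t).1)

theorem excessMass_ne_top (h : IsAlgorithmRun B₀ B₁ α q₀ q₁ c₀ c₁) (n : ℕ) (r : Ω → ℝ≥0) :
    excessMass μ (q₀ n) r ≠ ∞ :=
  ne_top_of_le_ne_top ENNReal.one_ne_top
    ((excessMass_le_lintegral _ _).trans_eq (h.mem₀ n).lintegral_eq_one)

theorem lipschitzWith_excessMass_toReal (h : IsAlgorithmRun B₀ B₁ α q₀ q₁ c₀ c₁) (n : ℕ) :
    LipschitzWith 1 fun t : ℝ≥0 => (excessMass μ (q₀ n) (t • q₁ n)).toReal := by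
  simpa [(h.mem₁ n).lintegral_eq_one] using lipschitzWith_excessMass_smul
    ((h.mem₀ n).lintegral_eq_one ▸ ENNReal.one_ne_top) (h.mem₁ n).aemeasurable
    ((h.mem₁ n).lintegral_eq_one ▸ ENNReal.one_ne_top)

theorem tendsto_excessMass_sub_succ (h : IsAlgorithmRun B₀ B₁ α q₀ q₁ c₀ c₁) (t : ℝ≥0) :
    Tendsto (fun n => (excessMass μ (q₀ n) (t • q₁ n)).toReal -
      (excessMass μ (q₀ (n + 1)) (t • q₁ (n + 1))).toReal) atTop (𝓝 0) := by
  have hanti : Antitone fun n => (excessMass μ (q₀ n) (t • q₁ n)).toReal := fun m n hmn =>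
    ENNReal.toReal_mono (h.excessMass_ne_top m _) (h.antitone_excessMass t hmn)
  have hlim := tendsto_atTop_ciInf hanti ⟨0, by rintro _ ⟨n, rfl⟩; exact ENNReal.toReal_nonneg⟩
  simpa using hlim.sub (hlim.comp (tendsto_add_atTop_nat 1))

theorem excessMass_succ_le_sub (h : IsAlgorithmRun B₀ B₁ α q₀ q₁ c₀ c₁) {s : ℝ≥0} {n : ℕ}
    (hs : ∀ᵐ ω ∂μ, q₀ (n + 1) ω ∈ Set.uIcc (q₀ n ω) (s * q₁ n ω)) :
    (excessMass μ (q₀ n) (q₀ (n + 1))).toReal ≤ (excessMass μ (q₀ n) (s • q₁ n)).toReal -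
      (excessMass μ (q₀ (n + 1)) (s • q₁ (n + 1))).toReal := by
  rw [le_sub_iff_add_le, ← ENNReal.toReal_add (h.excessMass_ne_top n _)
    (h.excessMass_ne_top (n + 1) _)]
  refine ENNReal.toReal_mono (h.excessMass_ne_top n _) ?_
  calc excessMass μ (q₀ n) (q₀ (n + 1)) + excessMass μ (q₀ (n + 1)) (s • q₁ (n + 1))
      ≤ excessMass μ (q₀ n) (q₀ (n + 1)) + excessMass μ (q₀ (n + 1)) (s • q₁ n) := by
        gcongr
        exact h.excessMass_smul_succ₁_le s n
    _ = excessMass μ (q₀ n) (s • q₁ n) := excessMass_add_excessMass_of_mem_uIcc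
        (h.mem₀ n).aemeasurable (h.mem₀ (n + 1)).aemeasurable hs

theorem tendsto_excessMass_succ (h : IsAlgorithmRun B₀ B₁ α q₀ q₁ c₀ c₁) :
    Tendsto (fun n => (excessMass μ (q₀ n) (q₀ (n + 1))).toReal) atTop (𝓝 0) := by
  obtain ⟨M, hM⟩ := h.exists_mem_uIcc_mul
  choose s hs hexcess using hM
  refine tendsto_zero_of_le_of_mul_le
    (fun n => (h.lipschitzWith_excessMass_toReal n).sub (h.lipschitzWith_excessMass_toReal (n + 1)))
    h.tendsto_excessMass_sub_succ (fun _ => ENNReal.toReal_nonneg)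
    (fun n => h.excessMass_succ_le_sub (hs n)) (M := M) fun n => ?_
  simpa using ENNReal.toReal_mono ENNReal.coe_ne_top (hexcess n)

theorem tendsto_l1Dist_succ (h : IsAlgorithmRun B₀ B₁ α q₀ q₁ c₀ c₁) :
    Tendsto (fun n => l1Dist μ (q₀ (n + 1)) (q₀ n)) atTop (𝓝 0) := by
  have hexcess := (ENNReal.tendsto_toReal_iff (fun n => h.excessMass_ne_top n (q₀ (n + 1)))
    ENNReal.zero_ne_top).1 h.tendsto_excessMass_succ
  have htwo := ENNReal.Tendsto.const_mul (a := 2) hexcess (.inr ENNReal.ofNat_ne_top)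
  rw [mul_zero] at htwo
  refine htwo.congr fun n => ?_
  rw [l1Dist_comm]
  exact (l1Dist_eq_two_mul_excessMass (h.mem₀ n).aemeasurable (h.mem₀ (n + 1)).aemeasurable
    ((h.mem₀ n).lintegral_eq_one.trans (h.mem₀ (n + 1)).lintegral_eq_one.symm)
    ((h.mem₀ n).lintegral_eq_one ▸ ENNReal.one_ne_top)).symm

theorem exists_tendsto_l1Dist_clip₀ (h : IsAlgorithmRun B₀ B₁ α q₀ q₁ c₀ c₁) :
    ∃ (M : ℝ≥0) (d : ℕ → ℝ≥0), α * M ≤ 1 ∧ (∀ n, 0 < d n ∧ d n ≤ M) ∧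
      Tendsto (fun n => l1Dist μ (q₀ n)
        (B₀.clip (d n) (fun ω => α * q₀ n ω + q₁ n ω))) atTop (𝓝 0) := by
  obtain ⟨M, hM, hαM, hstep⟩ := h.exists_root_bound
  refine ⟨M, fun n => min (c₀ n) M, hαM,
    fun n => ⟨lt_min (h.pos₀ n) hM, min_le_right _ _⟩, h.tendsto_l1Dist_succ.congr fun n => ?_⟩
  rw [l1Dist_comm]
  exact l1Dist_congr .rfl (hstep n)

theorem exists_tendsto_l1Dist_clip₁ (h : IsAlgorithmRun B₀ B₁ α q₀ q₁ c₀ c₁) :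
    ∃ (M : ℝ≥0) (d : ℕ → ℝ≥0), α * M ≤ 1 ∧ (∀ n, 0 < d n ∧ d n ≤ M) ∧
      Tendsto (fun n => l1Dist μ (q₁ n)
        (B₁.clip (d n) (fun ω => q₀ n ω + α * q₁ n ω))) atTop (𝓝 0) := by
  obtain ⟨M, hM, hαM, hstep⟩ := h.swap.exists_root_bound
  refine ⟨M, fun n => min (c₁ (n - 1)) M, hαM,
    fun n => ⟨lt_min (h.pos₁ _) hM, min_le_right _ _⟩, (tendsto_add_atTop_iff_nat 1).1 ?_⟩
  refine tendsto_of_tendsto_of_tendsto_of_le_of_le tendsto_const_nhds h.swap.tendsto_l1Dist_succ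
    (fun _ => zero_le) fun n => ?_
  have hclip : q₁ (n + 1) =ᵐ[μ] B₁.clip (min (c₁ n) M) (fun ω => α * q₁ n ω + q₀ (n + 1) ω) :=
    hstep n
  simp only [Nat.add_sub_cancel, add_comm (q₀ _ _)]
  rw [l1Dist_congr hclip .rfl, l1Dist_comm (q₁ (n + 1))]
  exact DensityBand.l1Dist_clip_smul_add_le
    (le_trans (by gcongr; exact min_le_right _ _) hαM) (h.mem₁ n).aemeasurable
    (h.mem₁ (n + 1)).aemeasurable (h.mem₀ (n + 1)).aemeasurable

end IsAlgorithmRun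

theorem mainTheorem4 {Ω : Type*} [MeasurableSpace Ω] (μ : Measure Ω)
    (B₀ B₁ : DensityBand μ) (α : ℝ≥0)
    (q₀ q₁ : ℕ → Ω → ℝ≥0) (c₀ c₁ : ℕ → ℝ≥0)
    (hrun : IsAlgorithmRun B₀ B₁ α q₀ q₁ c₀ c₁) :
    -- successive iterates merge
    (Tendsto (fun n => l1Dist μ (q₀ (n + 1)) (q₀ n)) atTop (𝓝 0) ∧
      Tendsto (fun n => l1Dist μ (q₁ (n + 1)) (q₁ n)) atTop (𝓝 0)) ∧
    -- the iterates satisfy the implicit equations asymptotically, with admissible constants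
    (∃ d₀ d₁ : ℕ → ℝ≥0,
      (∀ n, 0 < d₀ n ∧ α * d₀ n ≤ 1 ∧ 0 < d₁ n ∧ α * d₁ n ≤ 1) ∧
      Tendsto (fun n => l1Dist μ (q₀ n)
        (B₀.clip (d₀ n) (fun ω => α * q₀ n ω + q₁ n ω))) atTop (𝓝 0) ∧
      Tendsto (fun n => l1Dist μ (q₁ n)
        (B₁.clip (d₁ n) (fun ω => q₀ n ω + α * q₁ n ω))) atTop (𝓝 0)) ∧
    -- every limit point of the iterates is an exact solution in the two bands
    (∀ (φ : ℕ → ℕ) (r₀ r₁ : Ω → ℝ≥0), StrictMono φ → AEMeasurable r₀ μ → AEMeasurable r₁ μ →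
      Tendsto (fun k => l1Dist μ (q₀ (φ k)) r₀) atTop (𝓝 0) →
      Tendsto (fun k => l1Dist μ (q₁ (φ k)) r₁) atTop (𝓝 0) →
      B₀.Mem r₀ ∧ B₁.Mem r₁ ∧
      ∃ e₀ e₁ : ℝ≥0, α * e₀ ≤ 1 ∧ α * e₁ ≤ 1 ∧
        (∫⁻ ω, (B₀.lower ω : ℝ≥0∞) ∂μ < 1 → 0 < e₀) ∧
        (∫⁻ ω, (B₁.lower ω : ℝ≥0∞) ∂μ < 1 → 0 < e₁) ∧
        SolvesImplicitEquations B₀ B₁ α e₀ e₁ r₀ r₁) := by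
  obtain ⟨M₀, d₀, hM₀, hd₀, hclip₀⟩ := hrun.exists_tendsto_l1Dist_clip₀
  obtain ⟨M₁, d₁, hM₁, hd₁, hclip₁⟩ := hrun.exists_tendsto_l1Dist_clip₁
  have hα : ∀ {M d : ℝ≥0}, α * M ≤ 1 → d ≤ M → α * d ≤ 1 := fun hM hd =>
    (mul_le_mul_right hd α).trans hM
  refine ⟨⟨hrun.tendsto_l1Dist_succ, hrun.swap.tendsto_l1Dist_succ⟩, ⟨d₀, d₁, fun n =>
    ⟨(hd₀ n).1, hα hM₀ (hd₀ n).2, (hd₁ n).1, hα hM₁ (hd₁ n).2⟩, hclip₀, hclip₁⟩, ?_⟩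
  intro φ r₀ r₁ hφ hr₀ hr₁ hlim₀ hlim₁
  obtain ⟨hmem₀, e₀, he₀, hpos₀, hsol₀⟩ := DensityBand.Mem.exists_ae_eq_clip_smul_add_of_tendsto
    (fun k => hrun.mem₀ (φ k)) (fun k => hrun.mem₁ (φ k)) (fun k => (hd₀ (φ k)).2) hr₀ hr₁
    hlim₀ hlim₁ (hclip₀.comp hφ.tendsto_atTop)
  simp only [add_comm (q₀ _ _)] at hclip₁
  obtain ⟨hmem₁, e₁, he₁, hpos₁, hsol₁⟩ := DensityBand.Mem.exists_ae_eq_clip_smul_add_of_tendsto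
    (fun k => hrun.mem₁ (φ k)) (fun k => hrun.mem₀ (φ k)) (fun k => (hd₁ (φ k)).2) hr₁ hr₀
    hlim₁ hlim₀ (hclip₁.comp hφ.tendsto_atTop)
  simp only [add_comm (α * _)] at hsol₁
  exact ⟨hmem₀, hmem₁, e₀, e₁, hα hM₀ he₀, hα hM₁ he₁, hpos₀, hpos₁, hsol₀, hsol₁⟩
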